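/- Let $p\ge 1$ and $n_1,\dots,n_p\ge 1$ be integers, let $\mathcal H=\mathbb C^{n_1}\otimes\cdots\otimes\mathbb C^{n_p}$ with its standard inner product, and for $v\in\mathcal H$ put $$E(v):=1-\sup\Big\{\big|\langle w_1\otimes\cdots\otimes w_p,\,v\rangle\big|^2 : w_i\in\mathbb C^{n_i},\ \|w_i\|=1\ (1\le i\le p)\Big\};$$ for a pure state (unit vector) $v$ this is the geometric measure of entanglement. Let $U:\mathcal H\to\mathcal H$ be a linear operator. Then $E(Uv)=E(v)$ for all pure states $v\in\mathcal H$ if and only if there exist unitary matrices $U_i\in M_{n_i}(\mathbb C)$ $(1\le i\le p)$ and a permutation $\sigma$ of $\{1,\dots,p\}$ with $n_{\sigma(i)}=n_i$ for all $i$ such that $$U=S_\sigma\,(U_1\otimes\cdots\otimes U_p),$$ where $S_\sigma:\mathcal H\to\mathcal H$ is the swap operator, i.e. the linear operator with $S_\sigma(v_1\otimes\cdots\otimes v_p)=v_{\sigma(1)}\otimes\cdots\otimes v_{\sigma(p)}$ for all $v_i\in\mathbb C^{n_i}$. -/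

import Mathlib

open scoped TensorProduct

namespace GeomEnt

/-- The space `ℂ^{n_1} ⊗ ⋯ ⊗ ℂ^{n_p}`; each factor `ℂ^{n_i}` carries its Euclidean inner product. -/
abbrev MultiSpace {p : ℕ} (n : Fin p → ℕ) : Type :=
  ⨂[ℂ] i, EuclideanSpace ℂ (Fin (n i))

/-- The standard product basis `|j_1⟩ ⊗ ⋯ ⊗ |j_p⟩` of `ℂ^{n_1} ⊗ ⋯ ⊗ ℂ^{n_p}`. -/
noncomputable def stdBasis {p : ℕ} (n : Fin p → ℕ) :
    Module.Basis (∀ i, Fin (n i)) ℂ (MultiSpace n) :=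
  Basis.piTensorProduct fun i => (EuclideanSpace.basisFun (Fin (n i)) ℂ).toBasis

/-- A pure state is a unit vector of `ℂ^{n_1} ⊗ ⋯ ⊗ ℂ^{n_p}`, for the Euclidean norm in which the
standard product basis is orthonormal. -/
def IsPureState {p : ℕ} {n : Fin p → ℕ} (v : MultiSpace n) : Prop :=
  ∑ j, ‖(stdBasis n).repr v j‖ ^ 2 = 1

/-- The functional `⟨w_1| ⊗ ⋯ ⊗ ⟨w_p|`, which sends `v_1 ⊗ ⋯ ⊗ v_p` to `∏ i, ⟨w_i|v_i⟩`. -/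
noncomputable def braProduct {p : ℕ} {n : Fin p → ℕ}
    (w : ∀ i, EuclideanSpace ℂ (Fin (n i))) : MultiSpace n →ₗ[ℂ] ℂ :=
  PiTensorProduct.lift
    ((MultilinearMap.mkPiAlgebra ℂ (Fin p) ℂ).compLinearMap
      fun i => (innerSL ℂ (w i)).toLinearMap)

theorem braProduct_tprod {p : ℕ} {n : Fin p → ℕ}
    (w v : ∀ i, EuclideanSpace ℂ (Fin (n i))) :
    braProduct w (PiTensorProduct.tprod ℂ v) = ∏ i, inner ℂ (w i) (v i) := by
  simp [braProduct]

/-- The geometric measure of entanglement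
`E(v) = 1 - sup |(⟨w_1| ⊗ ⋯ ⊗ ⟨w_p|) v|²`, the supremum being over all unit vectors
`w_i ∈ ℂ^{n_i}`. -/
noncomputable def geomMeasure {p : ℕ} {n : Fin p → ℕ} (v : MultiSpace n) : ℝ :=
  1 - ⨆ w : {w : ∀ i, EuclideanSpace ℂ (Fin (n i)) // ∀ i, ‖w i‖ = 1}, ‖braProduct w.1 v‖ ^ 2

/-- The identification `ℂ^a = ℂ^b` for `a = b`. -/
noncomputable def factorCast {a b : ℕ} (h : a = b) :
    EuclideanSpace ℂ (Fin a) ≃ₗ[ℂ] EuclideanSpace ℂ (Fin b) :=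
  (LinearIsometryEquiv.piLpCongrLeft 2 ℂ ℂ (finCongr h)).toLinearEquiv

/-- The swap operator `S_σ : v_1 ⊗ ⋯ ⊗ v_p ↦ v_{σ(1)} ⊗ ⋯ ⊗ v_{σ(p)}`. It is an operator on
`ℂ^{n_1} ⊗ ⋯ ⊗ ℂ^{n_p}` when `σ` only permutes subsystems of equal dimension. -/
noncomputable def swapOperator {p : ℕ} {n : Fin p → ℕ} (σ : Equiv.Perm (Fin p))
    (hσ : ∀ i, n (σ i) = n i) : MultiSpace n →ₗ[ℂ] MultiSpace n :=
  (PiTensorProduct.map fun i => (factorCast (hσ i)).toLinearMap) ∘ₗ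
    (PiTensorProduct.reindex ℂ (fun i => EuclideanSpace ℂ (Fin (n i))) σ.symm).toLinearMap

theorem swapOperator_tprod {p : ℕ} {n : Fin p → ℕ} (σ : Equiv.Perm (Fin p))
    (hσ : ∀ i, n (σ i) = n i) (v : ∀ i, EuclideanSpace ℂ (Fin (n i))) :
    swapOperator σ hσ (PiTensorProduct.tprod ℂ v) =
      PiTensorProduct.tprod ℂ fun i => factorCast (hσ i) (v (σ i)) := by
  unfold swapOperator
  rw [LinearMap.comp_apply, LinearEquiv.coe_coe, PiTensorProduct.reindex_tprod]
  exact PiTensorProduct.map_tprod _ _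

end GeomEnt

/-! The quantity `1 - E(v)` is the largest squared overlap of `v` with a unit product vector.
Operators of the stated form permute the unit product vectors and preserve overlaps with them, so
they preserve `E`. The work is in the converse.

Homogeneity extends invariance of `E` from pure states to all vectors. Let `A` be the adjoint of
`U`. For a unit product vector `u` and `x = A u`, `‖x‖² = ⟨u, U x⟩`, hence `‖x‖⁴ ≤ 1 - E(U x) = 1 -
E(x) ≤ ‖x‖²` and `‖A u‖ ≤ 1`. For a unit product vector `w`, `E(U w) = E(w) = 0`, so some unit
product `u` has `|⟨A u, w⟩| = 1`; equality in Cauchy-Schwarz makes `w` a phase times `A u`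
(`exists_adjoint_tprod_eq`). Therefore `A` is onto and `U` is invertible. The same argument for
`U⁻¹`, whose adjoint is `A⁻¹`, shows that `A` and `A⁻¹` both map unit product vectors to unit
product vectors.

A linear bijection that preserves product vectors both ways acts on tuples of lines. A sum of two
product vectors can be a product vector only if their lines differ in at most one slot, so this
action respects Hamming adjacency, and such a map permutes the slots
(`exists_perm_of_differInOneSlot_iff`). This rigidity makes the linear map a permutation of the
slots followed by slotwise linear maps, which are isometries here. Thus `A⁻¹` has the stated form;
it preserves inner products, so it equals `U`. -/

namespace GeomEnt

/-! ### Adjacency-preserving injections of Hamming graphs. -/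

section HammingGraph

variable {ι : Type*} {X : ι → Type*}

/-- Two tuples that agree outside of at most one slot. -/
def DifferInOneSlot (P Q : ∀ i, X i) : Prop := ∃ k, ∀ l, l ≠ k → P l = Q l

theorem DifferInOneSlot.eq_of_ne {P Q : ∀ i, X i} (h : DifferInOneSlot P Q) {k l : ι}
    (hk : P k ≠ Q k) (hl : l ≠ k) : P l = Q l := by
  obtain ⟨m, hm⟩ := h
  rcases eq_or_ne k m with rfl | hkm
  · exact hm l hl
  · exact absurd (hm k hkm) hk

theorem differInOneSlot_update [DecidableEq ι] (P : ∀ i, X i) (i : ι) (a : X i) :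
    DifferInOneSlot P (Function.update P i a) :=
  ⟨i, fun l hl => by simp [hl]⟩

/-- A function that is unchanged by each replacement of an entry of a tuple by the corresponding
entry of `Q` takes the same value at `P` and at `Q`. -/
theorem eq_of_forall_update_eq [Fintype ι] [DecidableEq ι] {β : Type*} (g : (∀ i, X i) → β)
    (P Q : ∀ i, X i)
    (h : ∀ R j, P j ≠ Q j → g (Function.update R j (Q j)) = g R) : g Q = g P := by
  have key : ∀ s : Finset ι, g (s.piecewise Q P) = g P := by
    intro s
    induction s using Finset.induction_on with
    | empty => simp
    | insert j s hj ih =>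
      rw [Finset.piecewise_insert]
      by_cases hPQ : P j = Q j
      · rw [← hPQ]
        have : s.piecewise Q P j = P j := by simp [hj]
        rw [← this, Function.update_eq_self, ih]
      · rw [h _ _ hPQ, ih]
  simpa using key Finset.univ

/-- An injective map that preserves and reflects the relation of differing in at most one slot
permutes the slots. -/
theorem exists_perm_of_differInOneSlot_iff [Fintype ι] [DecidableEq ι] [∀ i, Nonempty (X i)]
    (F : (∀ i, X i) → ∀ i, X i) (hF : Function.Injective F)
    (hadj : ∀ P Q, DifferInOneSlot P Q ↔ DifferInOneSlot (F P) (F Q)) :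
    ∃ σ : Equiv.Perm ι, ∀ i P Q, P (σ i) = Q (σ i) → F P i = F Q i := by
  -- The relation `chg P` turns out not to depend on `P` and to be the graph of a bijection between
  -- the slots with at least two values; the inverse of that bijection gives `σ`.
  let chg (P : ∀ i, X i) (i k : ι) : Prop := ∃ a, F (Function.update P i a) k ≠ F P k
  have hup : ∀ P i a, DifferInOneSlot (F P) (F (Function.update P i a)) := fun P i a =>
    (hadj _ _).1 (differInOneSlot_update P i a)
  have huu : ∀ P i a b, DifferInOneSlot (F (Function.update P i b)) (F (Function.update P i a)) := by
    intro P i a b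
    have := hup (Function.update P i b) i a
    rwa [Function.update_idem] at this
  have uniq : ∀ P i k k', chg P i k → chg P i k' → k = k' := by
    rintro P i k k' ⟨a, ha⟩ ⟨b, hb⟩
    by_contra hkk
    have h1 := (hup P i a).eq_of_ne (Ne.symm ha) (Ne.symm hkk)
    have h2 := (hup P i b).eq_of_ne (Ne.symm hb) hkk
    have h3 : F (Function.update P i b) k ≠ F (Function.update P i a) k := by
      rw [← h2]; exact Ne.symm ha
    have h4 := (huu P i a b).eq_of_ne h3 (Ne.symm hkk)
    rw [h4] at hb
    exact hb h1.symm
  -- Otherwise the two modified images differ only in slot `k`, so by reflection the two modified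
  -- tuples would be adjacent, although they differ in both `i` and `j`.
  have disj : ∀ P i j k, i ≠ j → chg P i k → ¬ chg P j k := by
    rintro P i j k hij ⟨a, ha⟩ ⟨b, hb⟩
    have h1 : DifferInOneSlot (F (Function.update P i a)) (F (Function.update P j b)) :=
      ⟨k, fun l hl => ((hup P i a).eq_of_ne (Ne.symm ha) hl).symm.trans
        ((hup P j b).eq_of_ne (Ne.symm hb) hl)⟩
    have ha' : P i ≠ a := by rintro rfl; simp at ha
    have hb' : P j ≠ b := by rintro rfl; simp at hb
    have h2 := ((hadj _ _).2 h1).eq_of_ne (k := i) (l := j) (by simpa [hij] using ha'.symm) hij.symm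
    simp [hij.symm] at h2
    exact hb' h2
  have ex : ∀ P i a, P i ≠ a → ∃ k, F (Function.update P i a) k ≠ F P k := by
    intro P i a ha
    by_contra! h
    have := congrFun (hF (funext h)) i
    simp at this
    exact ha this.symm
  -- For `i ≠ j`, consider the square of tuples obtained by changing entry `i`, entry `j`, or both.
  -- If the change at `i` moved a different output slot on the far side, the images of two opposite
  -- corners would coincide, against injectivity.
  have inv : ∀ P i j k b, chg P i k → chg (Function.update P j b) i k := by
    rintro P i j k b ⟨a, ha⟩
    have ha' : P i ≠ a := by rintro rfl; simp at ha
    rcases eq_or_ne i j with rfl | hij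
    · by_cases hb : F (Function.update P i b) k = F P k
      · exact ⟨a, by rwa [Function.update_idem, hb]⟩
      · exact ⟨P i, by rw [Function.update_idem, Function.update_eq_self]; exact Ne.symm hb⟩
    · by_cases hPb : P j = b
      · subst hPb; rw [Function.update_eq_self]; exact ⟨a, ha⟩
      obtain ⟨l, hl⟩ := ex P j b hPb
      have hlk : l ≠ k := by rintro rfl; exact disj P i j l hij ⟨a, ha⟩ ⟨b, hl⟩
      obtain ⟨k2, hk2⟩ := ex (Function.update P j b) i a (by simpa [hij] using ha')
      rcases eq_or_ne k2 k with rfl | hkk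
      · exact ⟨a, hk2⟩
      exfalso
      have hcomm : Function.update (Function.update P j b) i a =
        Function.update (Function.update P i a) j b := Function.update_comm hij.symm _ _ _
      set P12 := Function.update (Function.update P j b) i a with hP12
      -- slot by slot comparison around the square
      have e1 : ∀ m, m ≠ k → F (Function.update P i a) m = F P m := fun m hm =>
        ((hup P i a).eq_of_ne (Ne.symm ha) hm).symm
      have e2 : ∀ m, m ≠ l → F (Function.update P j b) m = F P m := fun m hm =>
        ((hup P j b).eq_of_ne (Ne.symm hl) hm).symm
      have e3 : ∀ m, m ≠ k2 → F P12 m = F (Function.update P j b) m := fun m hm =>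
        ((hup (Function.update P j b) i a).eq_of_ne (Ne.symm hk2) hm).symm
      have hkP : F P12 k = F P k := by rw [e3 k hkk.symm, e2 k hlk.symm]
      have hk1 : F (Function.update P i a) k ≠ F P12 k := by rw [hkP]; exact ha
      have e4 : ∀ m, m ≠ k → F P12 m = F (Function.update P i a) m := fun m hm => by
        have := hup (Function.update P i a) j b
        rw [← hcomm] at this
        exact (this.eq_of_ne hk1 hm).symm
      have : P12 = P := by
        refine hF (funext fun m => ?_)
        by_cases hm : m = k
        · subst hm; exact hkP
        · rw [e4 m hm, e1 m hm]
      have := congrFun this i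
      rw [hP12] at this
      simp at this
      exact ha' this.symm
  have inv' : ∀ P Q i k, chg P i k → chg Q i k := by
    intro P Q i k h
    have := eq_of_forall_update_eq (fun R => chg R i k) P Q (fun R j _ => by
      refine propext ⟨fun h => ?_, fun h => inv _ _ _ _ _ h⟩
      have := inv _ i j k (R j) h
      rwa [Function.update_idem, Function.update_eq_self] at this)
    exact this.symm ▸ h
  let P₀ : ∀ i, X i := fun i => Classical.arbitrary _
  -- A slot with a single value is never changed, so only the nontrivial slots are matched and `σ`
  -- fixes the rest.
  have hτ : ∀ i : {i // Nontrivial (X i)}, ∃ k : {i // Nontrivial (X i)}, chg P₀ i k := by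
    rintro ⟨i, hi⟩
    obtain ⟨a, ha⟩ := exists_ne (P₀ i)
    obtain ⟨k, hk⟩ := ex P₀ i a ha.symm
    exact ⟨⟨k, ⟨_, _, hk⟩⟩, ⟨a, hk⟩⟩
  choose τ hτ using hτ
  have τinj : Function.Injective τ := by
    intro i j hij
    by_contra hne
    refine disj P₀ i j (τ i) (fun h => hne (Subtype.ext h)) (hτ i) ?_
    rw [hij]; exact hτ j
  classical
  let e : Equiv.Perm {i // Nontrivial (X i)} :=
    Equiv.ofBijective τ (Finite.injective_iff_bijective.1 τinj)
  refine ⟨(Equiv.Perm.ofSubtype e)⁻¹, fun i P Q hPQ => ?_⟩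
  by_cases hi : Nontrivial (X i)
  · obtain ⟨j, hj⟩ := e.surjective ⟨i, hi⟩
    have hσ : (Equiv.Perm.ofSubtype e)⁻¹ i = j := by
      rw [Equiv.Perm.inv_eq_iff_eq, Equiv.Perm.ofSubtype_apply_coe, hj]
    rw [hσ] at hPQ
    have hc : chg P₀ j i := by
      have h1 := hτ j
      have h2 : τ j = ⟨i, hi⟩ := hj
      rwa [h2] at h1
    refine (eq_of_forall_update_eq (fun R => F R i) P Q fun R m hm => ?_).symm
    by_contra hne
    exact disj R j m i (by rintro rfl; exact hm hPQ) (inv' _ _ _ _ hc) ⟨_, hne⟩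
  · rw [not_nontrivial_iff_subsingleton] at hi
    exact Subsingleton.elim _ _

end HammingGraph

/-! ### Product tensors and their lines. -/

section DecomposableTensors

open PiTensorProduct Function

variable {ι K : Type*} [Field K] {E : ι → Type*}
  [∀ i, AddCommGroup (E i)] [∀ i, Module K (E i)]

theorem exists_dual_ne_zero_of_notMem_span {M : Type*} [AddCommGroup M] [Module K M] {a b : M}
    (h : ¬ ∃ c : K, c • b = a) : ∃ f : Module.Dual K M, f a ≠ 0 ∧ f b = 0 := by
  have h' : a ∉ Submodule.span K {b} := by rwa [Submodule.mem_span_singleton]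
  obtain ⟨f, hf, hb⟩ := Submodule.exists_dual_map_eq_bot_of_notMem h' inferInstance
  refine ⟨f, hf, ?_⟩
  have : f b ∈ (Submodule.span K {b}).map f := ⟨b, Submodule.mem_span_singleton_self b, rfl⟩
  rwa [hb, Submodule.mem_bot] at this

/-- The tuple of lines spanned by a tuple of nonzero vectors. -/
def lines (v : ∀ i, E i) (hv : ∀ i, v i ≠ 0) (i : ι) : Projectivization K (E i) := Projectivization.mk K (v i) (hv i)

theorem exists_forall_dual_ne_zero {v : ∀ i, E i} (hv : ∀ i, v i ≠ 0) :
    ∃ f : ∀ i, Module.Dual K (E i), ∀ i, f i (v i) ≠ 0 := by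
  have : ∀ i, ∃ f : Module.Dual K (E i), f (v i) ≠ 0 := fun i =>
    Module.Projective.exists_dual_ne_zero K (hv i)
  choose f hf using this
  exact ⟨f, hf⟩

variable [Fintype ι]

theorem tprod_ne_zero {v : ∀ i, E i} (hv : ∀ i, v i ≠ 0) : tprod K v ≠ 0 := by
  obtain ⟨f, hf⟩ := exists_forall_dual_ne_zero (K := K) hv
  intro h
  have := dualDistrib_apply f v
  rw [h, map_zero] at this
  exact Finset.prod_ne_zero_iff.2 (fun i _ => hf i) this.symm

theorem lines_eq_of_tprod_eq_tprod [DecidableEq ι] {v w : ∀ i, E i} (hv : ∀ i, v i ≠ 0)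
    (hw : ∀ i, w i ≠ 0) (h : tprod K v = tprod K w) : lines (K := K) v hv = lines w hw := by
  funext i
  by_contra hne
  rw [lines, lines, Projectivization.mk_eq_mk_iff'] at hne
  obtain ⟨f, hf⟩ := exists_forall_dual_ne_zero (K := K) hv
  obtain ⟨g, hgv, hgw⟩ := exists_dual_ne_zero_of_notMem_span hne
  have h1 := dualDistrib_apply (update f i g) v
  have h2 := dualDistrib_apply (update f i g) w
  rw [h, h2, Finset.prod_eq_zero (Finset.mem_univ i) (by simpa using hgw)] at h1
  refine Finset.prod_ne_zero_iff.2 (fun j _ => ?_) h1.symm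
  rcases eq_or_ne j i with rfl | hj
  · simpa using hgv
  · simpa [hj] using hf j

theorem prod_update_update_dual [DecidableEq ι] (φ : ∀ i, Module.Dual K (E i)) {k l : ι}
    (hkl : k ≠ l) (a : Module.Dual K (E k)) (b : Module.Dual K (E l)) (m : ∀ i, E i) :
    dualDistrib (tprod K (update (update φ k a) l b)) (tprod K m) =
      a (m k) * b (m l) * ∏ i ∈ (Finset.univ.erase k).erase l, φ i (m i) := by
  rw [dualDistrib_apply, ← Finset.mul_prod_erase _ _ (Finset.mem_univ k),
    ← Finset.mul_prod_erase _ _ (Finset.mem_erase.2 ⟨hkl.symm, Finset.mem_univ l⟩), ← mul_assoc]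
  congr 1
  · simp [hkl]
  · refine Finset.prod_congr rfl fun i hi => ?_
    simp only [Finset.mem_erase] at hi
    simp [hi.1, hi.2.1]

/-- If the sum of two decomposable tensors is decomposable, then their factors are parallel in all
slots but at most one. -/
theorem differInOneSlot_of_tprod_add_tprod_eq [DecidableEq ι] [Nonempty ι] [Infinite K]
    {v w z : ∀ i, E i} (hv : ∀ i, v i ≠ 0) (hw : ∀ i, w i ≠ 0)
    (h : tprod K v + tprod K w = tprod K z) :
    DifferInOneSlot (lines (K := K) v hv) (lines w hw) := by
  by_contra hne
  simp only [DifferInOneSlot, not_exists, not_forall] at hne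
  obtain ⟨k, -, hk⟩ := hne (Classical.arbitrary ι)
  obtain ⟨l, hlk, hl⟩ := hne k
  have hk' := Ne.symm hk
  have hl' := Ne.symm hl
  simp only [lines, ne_eq, Projectivization.mk_eq_mk_iff'] at hk hl hk' hl'
  obtain ⟨f, hf, hf0⟩ := exists_dual_ne_zero_of_notMem_span hk
  obtain ⟨f', hf', hf0'⟩ := exists_dual_ne_zero_of_notMem_span hk'
  obtain ⟨g, hg, hg0⟩ := exists_dual_ne_zero_of_notMem_span hl
  obtain ⟨g', hg', hg0'⟩ := exists_dual_ne_zero_of_notMem_span hl'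
  have : ∀ i, ∃ φ : Module.Dual K (E i), φ (v i) ≠ 0 ∧ φ (w i) ≠ 0 := by
    intro i
    obtain ⟨φ, hφ⟩ := Module.exists_dual_forall_apply_ne_zero (K := K)
      (fun b : Bool => if b then v i else w i) (by intro b; cases b <;> simp [hv, hw])
    exact ⟨φ, by simpa using hφ true, by simpa using hφ false⟩
  choose φ hφv hφw using this
  -- Contracting all slots except `k` and `l` with `φ` reduces the question to tensors in two slots.
  have key : ∀ a b, dualDistrib (tprod K (update (update φ k a) l b)) (tprod K v) +
      dualDistrib (tprod K (update (update φ k a) l b)) (tprod K w) =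
      dualDistrib (tprod K (update (update φ k a) l b)) (tprod K z) := by
    intro a b
    rw [← h, map_add]
  simp only [prod_update_update_dual φ hlk.symm] at key
  set V := ∏ i ∈ (Finset.univ.erase k).erase l, φ i (v i) with hV
  set W := ∏ i ∈ (Finset.univ.erase k).erase l, φ i (w i) with hW
  set Z := ∏ i ∈ (Finset.univ.erase k).erase l, φ i (z i)
  have hV0 : V ≠ 0 := Finset.prod_ne_zero_iff.2 fun i _ => hφv i
  have hW0 : W ≠ 0 := Finset.prod_ne_zero_iff.2 fun i _ => hφw i
  have h1 := key f g
  have h2 := key f' g'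
  have h3 := key f g'
  have h4 := key f' g
  simp only [hf0, hf0', hg0, hg0', zero_mul, mul_zero, add_zero, zero_add] at h1 h2 h3 h4
  -- Evaluation on `f, f'` and `g, g'` turns the left side into a diagonal 2 by 2 matrix and the
  -- right side into one of rank at most one, so the determinant vanishes.
  have : (f (v k) * g (v l) * V) * (f' (w k) * g' (w l) * W) = 0 := by
    rw [h1, h2]
    linear_combination (-(f' (z k) * g (z l) * Z)) * h3
  exact mul_ne_zero (mul_ne_zero (mul_ne_zero hf hg) hV0) (mul_ne_zero (mul_ne_zero hf' hg') hW0) this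

/-- A decomposable tensor whose factors outside of slot `k` are parallel to those of `y`. -/
theorem exists_tprod_update_eq [DecidableEq ι] {y z : ∀ i, E i} (hy : ∀ i, y i ≠ 0)
    (hz : ∀ i, z i ≠ 0) (k : ι)
    (h : ∀ l, l ≠ k → lines (K := K) z hz l = lines y hy l) :
    ∃ u, tprod K z = tprod K (update y k u) := by
  have : ∀ l, ∃ c : K, z l = c • update y k (z k) l := by
    intro l
    rcases eq_or_ne l k with rfl | hl
    · exact ⟨1, by simp⟩
    · have := h l hl
      rw [lines, lines, Projectivization.mk_eq_mk_iff'] at this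
      obtain ⟨c, hc⟩ := this
      exact ⟨c, by simp [hl, hc]⟩
  choose c hc using this
  refine ⟨(∏ l, c l) • z k, ?_⟩
  rw [MultilinearMap.map_update_smul, ← MultilinearMap.map_smul_univ]
  exact congrArg _ (funext hc)

theorem toLinearMap_tprod_injective [DecidableEq ι] {y : ∀ i, E i} (hy : ∀ i, y i ≠ 0) (k : ι) :
    Injective ((PiTensorProduct.tprod K).toLinearMap y k) := by
  rw [← LinearMap.ker_eq_bot, LinearMap.ker_eq_bot']
  intro u hu
  by_contra hne
  refine tprod_ne_zero (K := K) (v := update y k u) (fun i => ?_) hu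
  rcases eq_or_ne i k with rfl | hi
  · simpa
  · simpa [hi] using hy i

/-- A linear map with every decomposable tensor as an eigenvector is a scalar on decomposable
tensors. -/
theorem map_tprod_eq_smul_of_forall [DecidableEq ι] (G : (⨂[K] i, E i) →ₗ[K] ⨂[K] i, E i)
    (hG : ∀ v : ∀ i, E i, (∀ i, v i ≠ 0) → ∃ c : K, G (tprod K v) = c • tprod K v)
    {x : ∀ i, E i} (hx : ∀ i, x i ≠ 0) {d : K} (hd : G (tprod K x) = d • tprod K x)
    {v : ∀ i, E i} (hv : ∀ i, v i ≠ 0) : G (tprod K v) = d • tprod K v := by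
  have step : ∀ (w : ∀ i, E i), (∀ i, w i ≠ 0) → ∀ j (b : E j) (d : K), b ≠ 0 →
      G (tprod K w) = d • tprod K w → G (tprod K (update w j b)) = d • tprod K (update w j b) := by
    intro w hw j b d hb hd
    have hu : ∀ a, a ≠ 0 → ∀ i, update w j a i ≠ 0 := by
      intro a ha i
      rcases eq_or_ne i j with rfl | hi
      · simpa
      · simpa [hi] using hw i
    obtain ⟨g, hg⟩ := LinearMap.exists_leftInverse_of_injective ((PiTensorProduct.tprod K).toLinearMap w j)
      (LinearMap.ker_eq_bot.2 (toLinearMap_tprod_injective hw j))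
    have hg' : ∀ a, g (tprod K (update w j a)) = a := fun a => LinearMap.congr_fun hg a
    obtain ⟨c, hc⟩ := LinearMap.exists_eq_smul_id_of_forall_notLinearIndependent
      -- With the other slots frozen, `G` becomes an endomorphism of `E j` for which every vector is
      -- an eigenvector, hence a scalar. So the eigenvalue survives a change of one slot.
      (f := g ∘ₗ G ∘ₗ (PiTensorProduct.tprod K).toLinearMap w j) (by
        intro a
        rw [LinearIndependent.pair_iff]
        intro hli
        by_cases ha : a = 0
        · simpa using (hli 1 0 (by simp [ha])).1
        · obtain ⟨c, hc⟩ := hG _ (hu a ha)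
          have := (hli c (-1) (by
            simp only [LinearMap.comp_apply]
            change c • a + (-1 : K) • g (G (tprod K (update w j a))) = 0
            rw [hc, map_smul, hg']
            simp)).2
          simp at this)
    have hval : ∀ a, a ≠ 0 → G (tprod K (update w j a)) = c • tprod K (update w j a) := by
      intro a ha
      obtain ⟨c', hc'⟩ := hG _ (hu a ha)
      have h1 : g (G (tprod K (update w j a))) = c • a := LinearMap.congr_fun hc a
      rw [hc', map_smul, hg'] at h1
      rw [hc', smul_left_injective K ha h1]
    have hcd : c = d := by
      have h1 := hval (w j) (hw j)
      rw [update_eq_self, hd] at h1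
      exact (smul_left_injective K (tprod_ne_zero hw) h1).symm
    rw [← hcd]
    exact hval b hb
  have := eq_of_forall_update_eq (X := fun i => {u : E i // u ≠ 0})
    (fun R => G (tprod K fun i => (R i : E i)) = d • tprod K fun i => (R i : E i))
    (fun i => ⟨x i, hx i⟩) (fun i => ⟨v i, hv i⟩) (by
      intro R j _
      have hval : ∀ (S : ∀ i, {u : E i // u ≠ 0}) (b : {u : E j // u ≠ 0}),
          (fun i => (update S j b i : E i)) = update (fun i => (S i : E i)) j b := by
        intro S b
        funext i
        rcases eq_or_ne i j with rfl | hi <;> simp [*]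
      refine propext ⟨fun h => ?_, fun h => ?_⟩
      · have := step _ (fun i => (update R j ⟨v j, hv j⟩ i).2) j (R j) d (R j).2 h
        rwa [← hval, update_idem, update_eq_self] at this
      · rw [hval]
        exact step _ (fun i => (R i).2) j _ d (hv j) h)
  exact this.symm ▸ hd

end DecomposableTensors

/-! ### Linear bijections preserving product tensors. -/

section ProductPreservers

open PiTensorProduct Function

variable {ι K : Type*} [Field K] {E : ι → Type*}
  [∀ i, AddCommGroup (E i)] [∀ i, Module K (E i)]

theorem lines_rep (P : ∀ i, Projectivization K (E i)) :
    lines (fun i => (P i).rep) (fun i => (P i).rep_nonzero) = P :=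
  funext fun i => (P i).mk_rep

theorem update_ne_zero [DecidableEq ι] {x : ∀ i, E i} (hx : ∀ i, x i ≠ 0) (j : ι) {b : E j}
    (hb : b ≠ 0) (i : ι) : update x j b i ≠ 0 := by
  rcases eq_or_ne i j with rfl | hi
  · simpa
  · simpa [hi] using hx i

variable [Fintype ι] [DecidableEq ι]

/-- A linear map that preserves nonzero decomposable tensors acts on tuples of lines. -/
theorem exists_map_lines (B : (⨂[K] i, E i) →ₗ[K] ⨂[K] i, E i)
    (hB : ∀ v : ∀ i, E i, (∀ i, v i ≠ 0) →
      ∃ y : ∀ i, E i, (∀ i, y i ≠ 0) ∧ B (tprod K v) = tprod K y) :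
    ∃ F : (∀ i, Projectivization K (E i)) → ∀ i, Projectivization K (E i),
      ∀ (v y : ∀ i, E i) (hv : ∀ i, v i ≠ 0) (hy : ∀ i, y i ≠ 0),
        B (tprod K v) = tprod K y → F (lines v hv) = lines y hy := by
  choose f hf0 hf using hB
  refine ⟨fun P => lines (f (fun i => (P i).rep) fun i => (P i).rep_nonzero) (hf0 _ _), ?_⟩
  intro v y hv hy hvy
  have := fun i => Projectivization.exists_smul_eq_mk_rep K (v i) (hv i)
  choose a ha using this
  have hay : ∀ i, (a i : K) • y i ≠ 0 := fun i => smul_ne_zero (a i).ne_zero (hy i)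
  have hrep : (fun i => (lines v hv i).rep) = fun i => (a i : K) • v i :=
    funext fun i => (ha i).symm
  have h1 : lines (K := K) (fun i => (a i : K) • y i) hay = lines y hy := by
    funext i
    rw [lines, lines, Projectivization.mk_eq_mk_iff']
    exact ⟨a i, rfl⟩
  rw [← h1]
  refine lines_eq_of_tprod_eq_tprod _ _ ?_
  rw [← hf, hrep, MultilinearMap.map_smul_univ, MultilinearMap.map_smul_univ, map_smul, hvy]

theorem differInOneSlot_map_lines [Nonempty ι] [Infinite K]
    (B : (⨂[K] i, E i) →ₗ[K] ⨂[K] i, E i)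
    (hB : ∀ v : ∀ i, E i, (∀ i, v i ≠ 0) →
      ∃ y : ∀ i, E i, (∀ i, y i ≠ 0) ∧ B (tprod K v) = tprod K y)
    (F : (∀ i, Projectivization K (E i)) → ∀ i, Projectivization K (E i))
    (hF : ∀ (v y : ∀ i, E i) (hv : ∀ i, v i ≠ 0) (hy : ∀ i, y i ≠ 0),
        B (tprod K v) = tprod K y → F (lines v hv) = lines y hy)
    {P Q : ∀ i, Projectivization K (E i)} (h : DifferInOneSlot P Q) :
    DifferInOneSlot (F P) (F Q) := by
  obtain ⟨k, hk⟩ := h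
  let v := fun i => (P i).rep
  have hv : ∀ i, v i ≠ 0 := fun i => (P i).rep_nonzero
  let w := fun i => (Q i).rep
  have hw : ∀ i, w i ≠ 0 := fun i => (Q i).rep_nonzero
  have hvw : update v k (w k) = w := by
    funext i
    rcases eq_or_ne i k with rfl | hi
    · simp
    · simp [hi, v, w, hk i hi]
  obtain ⟨y, hy, hvy⟩ := hB v hv
  obtain ⟨z, hz, hwz⟩ := hB w hw
  have hP : F P = lines y hy := by rw [← hF v y hv hy hvy, lines_rep]
  have hQ : F Q = lines z hz := by rw [← hF w z hw hz hwz, lines_rep]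
  -- The sum of the two product tensors has slot `k` equal to `v k + w k`; it must be nonzero for
  -- `hB` to apply. When it vanishes, the two lines coincide.
  by_cases h0 : v k + w k = 0
  · have : P = Q := by
      funext i
      by_cases hi : i = k
      · subst hi
        rw [← (P i).mk_rep, ← (Q i).mk_rep, Projectivization.mk_eq_mk_iff']
        exact ⟨-1, by rw [neg_one_smul]; exact (eq_neg_of_add_eq_zero_left h0).symm⟩
      · exact hk i hi
    rw [this]
    exact ⟨k, fun _ _ => rfl⟩
  · obtain ⟨u, -, hu⟩ := hB (update v k (v k + w k)) (update_ne_zero hv k h0)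
    rw [MultilinearMap.map_update_add, update_eq_self, hvw, map_add, hvy, hwz] at hu
    rw [hP, hQ]
    exact differInOneSlot_of_tprod_add_tprod_eq hy hz hu

/-- An invertible linear map such that it and its inverse preserve nonzero decomposable tensors
acts by a permutation of the slots followed by linear maps on the slots. -/
theorem exists_perm_forall_map_tprod_eq [Nonempty ι] [Infinite K]
    (B : (⨂[K] i, E i) ≃ₗ[K] ⨂[K] i, E i)
    (hB : ∀ v : ∀ i, E i, (∀ i, v i ≠ 0) →
      ∃ y : ∀ i, E i, (∀ i, y i ≠ 0) ∧ B (tprod K v) = tprod K y)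
    (hB' : ∀ v : ∀ i, E i, (∀ i, v i ≠ 0) →
      ∃ y : ∀ i, E i, (∀ i, y i ≠ 0) ∧ B.symm (tprod K v) = tprod K y)
    {x y : ∀ i, E i} (hx : ∀ i, x i ≠ 0) (hy : ∀ i, y i ≠ 0) (hxy : B (tprod K x) = tprod K y) :
    ∃ (σ : Equiv.Perm ι) (W : ∀ i, E (σ i) →ₗ[K] E i),
      (∀ i u, B (tprod K (update x (σ i) u)) = tprod K (update y i (W i u))) ∧
      ∀ v, B (tprod K v) = tprod K fun i => W i (v (σ i)) := by
  obtain ⟨F, hF⟩ := exists_map_lines B.toLinearMap hB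
  obtain ⟨F', hF'⟩ := exists_map_lines B.symm.toLinearMap hB'
  have hFF : LeftInverse F' F := by
    intro P
    obtain ⟨z, hz, hPz⟩ := hB (fun i => (P i).rep) fun i => (P i).rep_nonzero
    have h1 := hF _ z (fun i => (P i).rep_nonzero) hz hPz
    have h2 := hF' z _ hz (fun i => (P i).rep_nonzero) (by
      rw [← hPz]; exact B.symm_apply_apply _)
    rw [lines_rep] at h1 h2
    rw [h1, h2]
  have : ∀ i, Nonempty (Projectivization K (E i)) := fun i => ⟨lines x hx i⟩
  obtain ⟨σ, hσ⟩ := exists_perm_of_differInOneSlot_iff F hFF.injective fun P Q =>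
    ⟨differInOneSlot_map_lines _ hB F hF, fun h => by
      have := differInOneSlot_map_lines _ hB' F' hF' h
      rwa [hFF, hFF] at this⟩
  have hg : ∀ i, ∃ g : (⨂[K] i, E i) →ₗ[K] E i, ∀ u, g (tprod K (update y i u)) = u := by
    intro i
    obtain ⟨g, hg⟩ := LinearMap.exists_leftInverse_of_injective
      ((PiTensorProduct.tprod K).toLinearMap y i)
      (LinearMap.ker_eq_bot.2 (toLinearMap_tprod_injective hy i))
    exact ⟨g, fun u => LinearMap.congr_fun hg u⟩
  choose g hg using hg
  -- `W i` reads off how slot `i` of the image responds when slot `σ i` of the base point `x`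
  -- varies.
  let W : ∀ i, E (σ i) →ₗ[K] E i := fun i =>
    g i ∘ₗ B.toLinearMap ∘ₗ (PiTensorProduct.tprod K).toLinearMap x (σ i)
  have hWdef : ∀ i u, W i u = g i (B (tprod K (update x (σ i) u))) := fun i u => rfl
  have hW : ∀ i u, B (tprod K (update x (σ i) u)) = tprod K (update y i (W i u)) := by
    intro i u
    by_cases hu : u = 0
    · subst hu
      rw [map_zero, MultilinearMap.map_update_zero, MultilinearMap.map_update_zero, map_zero]
    · obtain ⟨z, hz, hBz⟩ := hB _ (update_ne_zero hx (σ i) hu)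
      obtain ⟨u', hu'⟩ := exists_tprod_update_eq (K := K) hy hz i (by
        intro l hl
        rw [← hF _ z (update_ne_zero hx (σ i) hu) hz hBz, ← hF x y hx hy hxy]
        refine hσ l _ _ ?_
        have : σ l ≠ σ i := fun h => hl (σ.injective h)
        simp [lines, this])
      rw [hWdef, hBz, hu', hg]
  have hWinj : ∀ i u, u ≠ 0 → W i u ≠ 0 := by
    intro i u hu h
    have := hW i u
    rw [h, MultilinearMap.map_update_zero, LinearEquiv.map_eq_zero_iff] at this
    exact tprod_ne_zero (update_ne_zero hx (σ i) hu) this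
  have hWx : ∀ i, W i (x (σ i)) = y i := by
    intro i
    rw [hWdef, update_eq_self, hxy]
    simpa using hg i (y i)
  refine ⟨σ, W, hW, ?_⟩
  let T : (⨂[K] i, E i) →ₗ[K] ⨂[K] i, E i :=
    PiTensorProduct.map W ∘ₗ (PiTensorProduct.reindex K E σ.symm).toLinearMap
  have hT : ∀ v, T (tprod K v) = tprod K fun i => W i (v (σ i)) := by
    intro v
    change PiTensorProduct.map W (PiTensorProduct.reindex K E σ.symm (tprod K v)) = _
    rw [PiTensorProduct.reindex_tprod]
    exact PiTensorProduct.map_tprod _ _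
  have hWv : ∀ v : ∀ i, E i, (∀ i, v i ≠ 0) → ∀ i, W i (v (σ i)) ≠ 0 := fun v hv i =>
    hWinj i _ (hv _)
  -- Line `i` of the image depends only on line `σ i` of the argument, so it may be computed next to
  -- the base point. Thus `T` and `B` agree on product tensors up to scalars; these are all equal,
  -- and the base point gives the value 1.
  have hpar : ∀ v : ∀ i, E i, (∀ i, v i ≠ 0) →
      ∃ c : K, (B.symm.toLinearMap ∘ₗ T) (tprod K v) = c • tprod K v := by
    intro v hv
    obtain ⟨z, hz, hBz⟩ := hB v hv
    have hl : lines (K := K) (fun i => W i (v (σ i))) (hWv v hv) = lines z hz := by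
      funext i
      have h1 := hF _ _ (update_ne_zero hx (σ i) (hv (σ i)))
        (update_ne_zero hy i (hWv v hv i)) (hW i (v (σ i)))
      have h2 := hσ i (lines (update x (σ i) (v (σ i))) (update_ne_zero hx (σ i) (hv (σ i))))
        (lines v hv) (by simp [lines])
      rw [h1, hF v z hv hz hBz] at h2
      rw [← h2]
      simp [lines]
    have : ∀ i, ∃ c : K, W i (v (σ i)) = c • z i := by
      intro i
      have := congrFun hl i
      rw [lines, lines, Projectivization.mk_eq_mk_iff'] at this
      obtain ⟨c, hc⟩ := this
      exact ⟨c, hc.symm⟩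
    choose c hc using this
    refine ⟨∏ i, c i, ?_⟩
    rw [LinearMap.comp_apply, hT, funext hc, MultilinearMap.map_smul_univ, map_smul, ← hBz]
    simp
  have hone : ∀ v : ∀ i, E i, (∀ i, v i ≠ 0) →
      (B.symm.toLinearMap ∘ₗ T) (tprod K v) = (1 : K) • tprod K v := by
    intro v hv
    refine map_tprod_eq_smul_of_forall _ hpar hx ?_ hv
    rw [LinearMap.comp_apply, hT, funext hWx, ← hxy]
    simp
  intro v
  by_cases hv : ∀ i, v i ≠ 0
  · have := hone v hv
    rw [LinearMap.comp_apply, hT, one_smul] at this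
    rw [← this]
    simp
  · push Not at hv
    obtain ⟨j', hj⟩ := hv
    obtain ⟨j, rfl⟩ := σ.surjective j'
    rw [MultilinearMap.map_coord_zero _ (σ j) hj, map_zero,
      MultilinearMap.map_coord_zero _ j (by rw [hj, map_zero])]

end ProductPreservers

/-! ### Product preservers with norm control. -/

section Isometric

open PiTensorProduct Function

variable {ι : Type*} [Fintype ι] {E : ι → Type*}
  [∀ i, NormedAddCommGroup (E i)] [∀ i, InnerProductSpace ℂ (E i)]

/-- Pair both tensors with the functional `⨂ ⟨v i|` and apply Cauchy-Schwarz in each slot. -/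
theorem prod_norm_le_of_tprod_eq_tprod {v w : ∀ i, E i} (h : tprod ℂ v = tprod ℂ w) :
    ∏ i, ‖v i‖ ≤ ∏ i, ‖w i‖ := by
  by_cases hv : ∏ i, ‖v i‖ = 0
  · rw [hv]; exact Finset.prod_nonneg fun i _ => norm_nonneg _
  have h1 := dualDistrib_apply (fun i => (innerSL ℂ (v i)).toLinearMap) v
  have h2 := dualDistrib_apply (fun i => (innerSL ℂ (v i)).toLinearMap) w
  rw [h, h2] at h1
  have h3 := congrArg norm h1
  simp only [ContinuousLinearMap.coe_coe, innerSL_apply_apply, norm_prod, inner_self_eq_norm_sq_to_K,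
    norm_pow] at h3
  have h4 : (∏ i, ‖v i‖) * ∏ i, ‖v i‖ ≤ (∏ i, ‖v i‖) * ∏ i, ‖w i‖ := by
    calc (∏ i, ‖v i‖) * ∏ i, ‖v i‖ = ∏ i, ‖inner ℂ (v i) (w i)‖ := by
          rw [h3, ← Finset.prod_mul_distrib]
          exact Finset.prod_congr rfl fun i _ => by simp [sq]
      _ ≤ ∏ i, (‖v i‖ * ‖w i‖) :=
          Finset.prod_le_prod (fun i _ => norm_nonneg _) fun i _ => norm_inner_le_norm _ _
      _ = _ := Finset.prod_mul_distrib
  exact le_of_mul_le_mul_left h4 (lt_of_le_of_ne (Finset.prod_nonneg fun i _ => norm_nonneg _)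
    (Ne.symm hv))

theorem prod_norm_eq_of_tprod_eq_tprod {v w : ∀ i, E i} (h : tprod ℂ v = tprod ℂ w) :
    ∏ i, ‖v i‖ = ∏ i, ‖w i‖ :=
  le_antisymm (prod_norm_le_of_tprod_eq_tprod h) (prod_norm_le_of_tprod_eq_tprod h.symm)

theorem exists_map_tprod_eq_of_forall_norm_eq_one (B : (⨂[ℂ] i, E i) →ₗ[ℂ] ⨂[ℂ] i, E i)
    (hB : ∀ v : ∀ i, E i, (∀ i, ‖v i‖ = 1) →
      ∃ y : ∀ i, E i, (∀ i, ‖y i‖ = 1) ∧ B (tprod ℂ v) = tprod ℂ y)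
    (v : ∀ i, E i) (hv : ∀ i, v i ≠ 0) :
    ∃ y : ∀ i, E i, (∀ i, y i ≠ 0) ∧ B (tprod ℂ v) = tprod ℂ y := by
  have hv' : ∀ i, ‖((‖v i‖ : ℂ)⁻¹) • v i‖ = 1 := fun i => norm_smul_inv_norm (hv i)
  have hc : ∀ i, (‖v i‖ : ℂ) ≠ 0 := fun i => by simpa using hv i
  obtain ⟨y, hy, hvy⟩ := hB _ hv'
  refine ⟨fun i => (‖v i‖ : ℂ) • y i, fun i => ?_, ?_⟩
  · exact smul_ne_zero (hc i) (by rw [← norm_ne_zero_iff, hy]; exact one_ne_zero)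
  · rw [MultilinearMap.map_smul_univ, ← hvy, ← map_smul, ← MultilinearMap.map_smul_univ]
    congr 2
    funext i
    rw [smul_smul, mul_inv_cancel₀ (hc i), one_smul]

/-- An invertible linear map that maps unit product vectors onto unit product vectors acts by a
permutation of the slots followed by linear isometries on the slots. -/
theorem exists_perm_linearIsometry [DecidableEq ι] [Nonempty ι] [∀ i, Nontrivial (E i)]
    (B : (⨂[ℂ] i, E i) ≃ₗ[ℂ] ⨂[ℂ] i, E i)
    (hB : ∀ v : ∀ i, E i, (∀ i, ‖v i‖ = 1) →
      ∃ y : ∀ i, E i, (∀ i, ‖y i‖ = 1) ∧ B (tprod ℂ v) = tprod ℂ y)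
    (hB' : ∀ v : ∀ i, E i, (∀ i, ‖v i‖ = 1) →
      ∃ y : ∀ i, E i, (∀ i, ‖y i‖ = 1) ∧ B.symm (tprod ℂ v) = tprod ℂ y) :
    ∃ (σ : Equiv.Perm ι) (W : ∀ i, E (σ i) →ₗᵢ[ℂ] E i),
      ∀ v, B (tprod ℂ v) = tprod ℂ fun i => W i (v (σ i)) := by
  have : ∀ i, ∃ x : E i, ‖x‖ = 1 := fun i => exists_norm_eq (E i) zero_le_one
  choose x hx using this
  obtain ⟨y, hy, hxy⟩ := hB x hx
  have ne0 : ∀ {v : ∀ i, E i}, (∀ i, ‖v i‖ = 1) → ∀ i, v i ≠ 0 := fun h i => by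
    rw [← norm_ne_zero_iff, h]; exact one_ne_zero
  obtain ⟨σ, W, hW, hBW⟩ := exists_perm_forall_map_tprod_eq B
    (exists_map_tprod_eq_of_forall_norm_eq_one B.toLinearMap hB)
    (exists_map_tprod_eq_of_forall_norm_eq_one B.symm.toLinearMap hB') (ne0 hx) (ne0 hy) hxy
  have hunit : ∀ i u, ‖u‖ = 1 → ‖W i u‖ = 1 := by
    intro i u hu
    have hxu : ∀ j, ‖update x (σ i) u j‖ = 1 := by
      intro j
      rcases eq_or_ne j (σ i) with rfl | hj
      · simpa
      · simpa [hj] using hx j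
    obtain ⟨z, hz, hBz⟩ := hB _ hxu
    rw [hW] at hBz
    have := prod_norm_eq_of_tprod_eq_tprod hBz
    rw [Finset.prod_congr rfl (fun j _ => hz j), Finset.prod_const_one,
      ← Finset.mul_prod_erase _ _ (Finset.mem_univ i), update_self,
      Finset.prod_eq_one (fun j hj => by simp [Finset.ne_of_mem_erase hj, hy]), mul_one] at this
    exact this
  refine ⟨σ, fun i => ⟨W i, fun u => ?_⟩, hBW⟩
  by_cases hu : u = 0
  · simp [hu]
  have h1 := hunit i _ (norm_smul_inv_norm (𝕜 := ℂ) hu)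
  rw [map_smul, norm_smul, norm_inv] at h1
  have hu' : ‖u‖ ≠ 0 := norm_ne_zero_iff.2 hu
  simp at h1
  field_simp at h1
  exact h1

end Isometric

/-! ### From slotwise isometries to unitary matrices. -/

section Unitary

theorem mem_unitaryGroup_iff_inner {m : ℕ} (M : Matrix (Fin m) (Fin m) ℂ) :
    M ∈ Matrix.unitaryGroup (Fin m) ℂ ↔ ∀ x y : EuclideanSpace ℂ (Fin m),
      inner ℂ (Matrix.toEuclideanLin M x) (Matrix.toEuclideanLin M y) = inner ℂ x y := by
  have key : ∀ x y : EuclideanSpace ℂ (Fin m),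
      inner ℂ (Matrix.toEuclideanLin M x) (Matrix.toEuclideanLin M y) =
        inner ℂ x (Matrix.toEuclideanLin (star M * M) y) := by
    intro x y
    have : Matrix.toEuclideanLin (star M * M) y =
        Matrix.toEuclideanLin M.conjTranspose (Matrix.toEuclideanLin M y) := by
      simp [Matrix.toLpLin_apply, Matrix.mulVec_mulVec, Matrix.star_eq_conjTranspose]
    rw [this, Matrix.toEuclideanLin_conjTranspose_eq_adjoint, LinearMap.adjoint_inner_right]
  rw [Matrix.mem_unitaryGroup_iff']
  constructor
  · intro h x y
    rw [key, h]
    simp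
  · intro h
    apply (Matrix.toEuclideanLin (𝕜 := ℂ) (m := Fin m) (n := Fin m)).injective
    ext1 y
    refine ext_inner_left ℂ fun x => ?_
    rw [← key, h]
    simp

variable {p : ℕ} {n : Fin p → ℕ}

theorem inner_factorCast {a b : ℕ} (h : a = b) (x y : EuclideanSpace ℂ (Fin a)) :
    inner ℂ (factorCast h x) (factorCast h y) = inner ℂ x y :=
  (LinearIsometryEquiv.piLpCongrLeft 2 ℂ ℂ (finCongr h)).inner_map_map x y

theorem exists_eq_swapOperator_comp_map (hp : 1 ≤ p) (hn : ∀ i, n i ≠ 0)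
    (B : MultiSpace n ≃ₗ[ℂ] MultiSpace n)
    (hB : ∀ v : ∀ i, EuclideanSpace ℂ (Fin (n i)), (∀ i, ‖v i‖ = 1) →
      ∃ y : ∀ i, EuclideanSpace ℂ (Fin (n i)), (∀ i, ‖y i‖ = 1) ∧
        B (PiTensorProduct.tprod ℂ v) = PiTensorProduct.tprod ℂ y)
    (hB' : ∀ v : ∀ i, EuclideanSpace ℂ (Fin (n i)), (∀ i, ‖v i‖ = 1) →
      ∃ y : ∀ i, EuclideanSpace ℂ (Fin (n i)), (∀ i, ‖y i‖ = 1) ∧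
        B.symm (PiTensorProduct.tprod ℂ v) = PiTensorProduct.tprod ℂ y) :
    ∃ (V : ∀ i, Matrix.unitaryGroup (Fin (n i)) ℂ) (σ : Equiv.Perm (Fin p))
      (hσ : ∀ i, n (σ i) = n i),
      B.toLinearMap = swapOperator σ hσ ∘ₗ
        PiTensorProduct.map fun i =>
          Matrix.toEuclideanLin (V i : Matrix (Fin (n i)) (Fin (n i)) ℂ) := by
  have : Nonempty (Fin p) := ⟨⟨0, hp⟩⟩
  have : ∀ i, Nonempty (Fin (n i)) := fun i => ⟨⟨0, Nat.pos_of_ne_zero (hn i)⟩⟩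
  obtain ⟨σ, W, hW⟩ := exists_perm_linearIsometry B hB hB'
  have hle : ∀ i, n (σ i) ≤ n i := fun i => by
    have := LinearMap.finrank_le_finrank_of_injective (W i).injective
    simpa using this
  have hσ : ∀ i, n (σ i) = n i := fun i =>
    (Finset.sum_eq_sum_iff_of_le fun i _ => hle i).1 (Equiv.sum_comp σ n) i (Finset.mem_univ i)
  have hM : ∀ i, ∃ M : Matrix.unitaryGroup (Fin (n (σ i))) ℂ, ∀ u,
      factorCast (hσ i) (Matrix.toEuclideanLin (M : Matrix _ _ ℂ) u) = W i u := by
    intro i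
    let f : EuclideanSpace ℂ (Fin (n (σ i))) →ₗ[ℂ] EuclideanSpace ℂ (Fin (n (σ i))) :=
      (factorCast (hσ i)).symm.toLinearMap ∘ₗ (W i).toLinearMap
    have hf : ∀ u, factorCast (hσ i) (Matrix.toEuclideanLin (Matrix.toEuclideanLin.symm f) u) =
        W i u := by
      intro u
      rw [LinearEquiv.apply_symm_apply]
      exact (factorCast (hσ i)).apply_symm_apply _
    refine ⟨⟨Matrix.toEuclideanLin.symm f, ?_⟩, hf⟩
    rw [mem_unitaryGroup_iff_inner]
    intro x y
    rw [← inner_factorCast (hσ i), hf, hf, LinearIsometry.inner_map_map]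
  choose M hM using hM
  refine ⟨Equiv.piCongrLeft (fun i => Matrix.unitaryGroup (Fin (n i)) ℂ) σ M, σ, hσ, ?_⟩
  refine PiTensorProduct.ext (MultilinearMap.ext fun v => ?_)
  simp only [LinearMap.compMultilinearMap_apply, LinearMap.comp_apply]
  rw [PiTensorProduct.map_tprod, swapOperator_tprod]
  refine (hW v).trans (congrArg _ (funext fun i => ?_))
  rw [Equiv.piCongrLeft_apply_apply, hM]

end Unitary

/-! ### Overlaps with product vectors and the adjoint of a preserver. -/

section Overlap

variable {p : ℕ} {n : Fin p → ℕ}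

/-- The coordinates of a tensor in the standard product basis, as a vector of a Hilbert space. -/
noncomputable def toEuclidean (n : Fin p → ℕ) :
    MultiSpace n ≃ₗ[ℂ] EuclideanSpace ℂ (∀ i, Fin (n i)) :=
  (stdBasis n).equivFun ≪≫ₗ (WithLp.linearEquiv 2 ℂ _).symm

theorem toEuclidean_apply (v : MultiSpace n) (j : ∀ i, Fin (n i)) :
    toEuclidean n v j = (stdBasis n).repr v j := rfl

theorem isPureState_iff_norm (v : MultiSpace n) : IsPureState v ↔ ‖toEuclidean n v‖ = 1 := by
  rw [← sq_eq_sq₀ (norm_nonneg _) zero_le_one, EuclideanSpace.norm_sq_eq, one_pow]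
  rfl

theorem stdBasis_apply (j : ∀ i, Fin (n i)) :
    stdBasis n j = PiTensorProduct.tprod ℂ fun i => EuclideanSpace.single (j i) 1 := by
  rw [stdBasis, Basis.piTensorProduct_apply]
  simp

theorem inner_toEuclidean_tprod (w : ∀ i, EuclideanSpace ℂ (Fin (n i))) (v : MultiSpace n) :
    inner ℂ (toEuclidean n (PiTensorProduct.tprod ℂ w)) (toEuclidean n v) = braProduct w v := by
  have : ((innerSL ℂ (toEuclidean n (PiTensorProduct.tprod ℂ w))).toLinearMap ∘ₗ
      (toEuclidean n).toLinearMap) = braProduct w := by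
    refine PiTensorProduct.ext (MultilinearMap.ext fun u => ?_)
    simp only [LinearMap.compMultilinearMap_apply, LinearMap.comp_apply, braProduct_tprod]
    change inner ℂ (toEuclidean n (PiTensorProduct.tprod ℂ w))
      (toEuclidean n (PiTensorProduct.tprod ℂ u)) = _
    simp only [PiLp.inner_apply, toEuclidean_apply, stdBasis,
      Basis.piTensorProduct_repr_tprod_apply, Finset.prod_univ_sum, Fintype.piFinset_univ]
    refine Finset.sum_congr rfl fun j _ => ?_
    simp [Finset.prod_mul_distrib]
  exact LinearMap.congr_fun this v

theorem repr_eq_braProduct (v : MultiSpace n) (j : ∀ i, Fin (n i)) :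
    (stdBasis n).repr v j = braProduct (fun i => EuclideanSpace.single (j i) 1) v := by
  rw [← inner_toEuclidean_tprod, ← stdBasis_apply]
  have : toEuclidean n (stdBasis n j) = EuclideanSpace.single j 1 := by
    ext k
    rw [toEuclidean_apply]
    simp [Finsupp.single_apply, eq_comm]
  rw [this, EuclideanSpace.inner_single_left]
  simp [toEuclidean_apply]

theorem ext_braProduct {v v' : MultiSpace n}
    (h : ∀ w : ∀ i, EuclideanSpace ℂ (Fin (n i)), (∀ i, ‖w i‖ = 1) →
      braProduct w v = braProduct w v') : v = v' := by
  refine (stdBasis n).ext_elem fun j => ?_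
  rw [repr_eq_braProduct, repr_eq_braProduct]
  exact h _ fun i => by simp

theorem norm_toEuclidean_tprod {w : ∀ i, EuclideanSpace ℂ (Fin (n i))} (hw : ∀ i, ‖w i‖ = 1) :
    ‖toEuclidean n (PiTensorProduct.tprod ℂ w)‖ = 1 := by
  have h := inner_toEuclidean_tprod w (PiTensorProduct.tprod ℂ w)
  rw [braProduct_tprod] at h
  simp only [inner_self_eq_norm_sq_to_K, hw] at h
  have h' : ‖toEuclidean n (PiTensorProduct.tprod ℂ w)‖ ^ 2 = 1 := by
    have := congrArg norm h
    simpa using this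
  exact (pow_eq_one_iff_of_nonneg (norm_nonneg _) two_ne_zero).1 h'

theorem norm_braProduct_le {w : ∀ i, EuclideanSpace ℂ (Fin (n i))} (hw : ∀ i, ‖w i‖ = 1)
    (v : MultiSpace n) : ‖braProduct w v‖ ≤ ‖toEuclidean n v‖ := by
  rw [← inner_toEuclidean_tprod]
  refine (norm_inner_le_norm _ _).trans ?_
  rw [norm_toEuclidean_tprod hw, one_mul]

theorem continuous_braProduct (v : MultiSpace n) :
    Continuous fun w : ∀ i, EuclideanSpace ℂ (Fin (n i)) => braProduct w v := by
  induction v using PiTensorProduct.induction_on with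
  | smul_tprod r f =>
    simp only [map_smul, braProduct_tprod]
    fun_prop
  | add x y hx hy =>
    simp only [map_add]
    exact hx.add hy

theorem sq_norm_braProduct_le (v : MultiSpace n) {w : ∀ i, EuclideanSpace ℂ (Fin (n i))}
    (hw : ∀ i, ‖w i‖ = 1) : ‖braProduct w v‖ ^ 2 ≤ 1 - geomMeasure v := by
  rw [geomMeasure, sub_sub_cancel]
  refine le_ciSup (f := fun w : {w : ∀ i, EuclideanSpace ℂ (Fin (n i)) // ∀ i, ‖w i‖ = 1} =>
    ‖braProduct w.1 v‖ ^ 2) ⟨‖toEuclidean n v‖ ^ 2, ?_⟩ ⟨w, hw⟩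
  rintro _ ⟨u, rfl⟩
  exact pow_le_pow_left₀ (norm_nonneg _) (norm_braProduct_le u.2 v) 2

/-- The supremum is attained because a product of unit spheres is compact; nonzero dimensions make
it nonempty. -/
theorem exists_sq_norm_braProduct_eq (hn : ∀ i, n i ≠ 0) (v : MultiSpace n) :
    ∃ w : ∀ i, EuclideanSpace ℂ (Fin (n i)), (∀ i, ‖w i‖ = 1) ∧
      ‖braProduct w v‖ ^ 2 = 1 - geomMeasure v := by
  have : ∀ i, Nonempty (Fin (n i)) := fun i => ⟨⟨0, Nat.pos_of_ne_zero (hn i)⟩⟩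
  have hx : ∀ i, ∃ x : EuclideanSpace ℂ (Fin (n i)), ‖x‖ = 1 := fun i => exists_norm_eq _ zero_le_one
  choose x hx using hx
  have hmem : ∀ w : ∀ i, EuclideanSpace ℂ (Fin (n i)),
      w ∈ Set.univ.pi (fun i => Metric.sphere (0 : EuclideanSpace ℂ (Fin (n i))) 1) ↔
        ∀ i, ‖w i‖ = 1 := by
    simp
  obtain ⟨w, hw, hmax⟩ := (isCompact_univ_pi fun i =>
    isCompact_sphere (0 : EuclideanSpace ℂ (Fin (n i))) 1).exists_isMaxOn ⟨x, (hmem x).2 hx⟩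
      ((continuous_braProduct v).norm.pow 2).continuousOn
  have hw' := (hmem w).1 hw
  refine ⟨w, hw', le_antisymm (sq_norm_braProduct_le v hw') ?_⟩
  rw [geomMeasure, sub_sub_cancel]
  have : Nonempty {w : ∀ i, EuclideanSpace ℂ (Fin (n i)) // ∀ i, ‖w i‖ = 1} := ⟨⟨x, hx⟩⟩
  exact ciSup_le fun u => hmax ((hmem u.1).2 u.2)

/-- This homogeneity carries invariance of `E` from pure states to all vectors, as needed at the
unnormalised vectors `A u`. -/
theorem one_sub_geomMeasure_smul (c : ℂ) (v : MultiSpace n) :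
    1 - geomMeasure (c • v) = ‖c‖ ^ 2 * (1 - geomMeasure v) := by
  simp only [geomMeasure, sub_sub_cancel, map_smul, norm_smul, mul_pow]
  rw [Real.mul_iSup_of_nonneg (sq_nonneg _)]

theorem geomMeasure_map_eq_of_forall_isPureState (U : MultiSpace n →ₗ[ℂ] MultiSpace n)
    (hU : ∀ v : MultiSpace n, IsPureState v → geomMeasure (U v) = geomMeasure v)
    (v : MultiSpace n) : geomMeasure (U v) = geomMeasure v := by
  by_cases hv : v = 0
  · rw [hv, map_zero]
  have hv' : toEuclidean n v ≠ 0 := by simpa using hv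
  have hne : (‖toEuclidean n v‖ : ℂ) ≠ 0 := by simpa using hv
  have h1 : IsPureState ((‖toEuclidean n v‖ : ℂ)⁻¹ • v) := by
    rw [isPureState_iff_norm, map_smul]
    exact norm_smul_inv_norm hv'
  have h2 := hU _ h1
  have h3 : v = (‖toEuclidean n v‖ : ℂ) • ((‖toEuclidean n v‖ : ℂ)⁻¹ • v) := by
    rw [smul_smul, mul_inv_cancel₀ hne, one_smul]
  have h4 : 1 - geomMeasure (U v) = 1 - geomMeasure v := by
    rw [h3, map_smul, one_sub_geomMeasure_smul, one_sub_geomMeasure_smul, h2]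
  linarith

theorem geomMeasure_tprod {w : ∀ i, EuclideanSpace ℂ (Fin (n i))} (hn : ∀ i, n i ≠ 0)
    (hw : ∀ i, ‖w i‖ = 1) : geomMeasure (PiTensorProduct.tprod ℂ w : MultiSpace n) = 0 := by
  have h1 := sq_norm_braProduct_le (PiTensorProduct.tprod ℂ w) hw
  rw [braProduct_tprod] at h1
  simp only [inner_self_eq_norm_sq_to_K, hw] at h1
  simp at h1
  obtain ⟨u, hu, h2⟩ := exists_sq_norm_braProduct_eq hn (PiTensorProduct.tprod ℂ w)
  have h3 := norm_braProduct_le hu (PiTensorProduct.tprod ℂ w)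
  rw [norm_toEuclidean_tprod hw] at h3
  have h4 := pow_le_one₀ (n := 2) (norm_nonneg _) h3
  linarith

/-- If `U` preserves the geometric measure, then the unit product vectors are images of unit
product vectors under the adjoint of `U`. -/
theorem exists_adjoint_tprod_eq (hp : 1 ≤ p) (hn : ∀ i, n i ≠ 0)
    (U A : MultiSpace n →ₗ[ℂ] MultiSpace n)
    (hU : ∀ v, geomMeasure (U v) = geomMeasure v)
    (hA : ∀ x y, inner ℂ (toEuclidean n (A x)) (toEuclidean n y) =
      inner ℂ (toEuclidean n x) (toEuclidean n (U y)))
    {w : ∀ i, EuclideanSpace ℂ (Fin (n i))} (hw : ∀ i, ‖w i‖ = 1) :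
    ∃ y : ∀ i, EuclideanSpace ℂ (Fin (n i)), (∀ i, ‖y i‖ = 1) ∧
      A (PiTensorProduct.tprod ℂ y) = PiTensorProduct.tprod ℂ w := by
  have hle : ∀ u : ∀ i, EuclideanSpace ℂ (Fin (n i)), (∀ i, ‖u i‖ = 1) →
      ‖toEuclidean n (A (PiTensorProduct.tprod ℂ u))‖ ≤ 1 := by
    intro u hu
    set x := A (PiTensorProduct.tprod ℂ u) with hx
    have h1 : ‖toEuclidean n x‖ ^ 2 = ‖braProduct u (U x)‖ := by
      rw [← inner_toEuclidean_tprod, ← hA, ← hx, inner_self_eq_norm_sq_to_K]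
      simp
    have h2 := sq_norm_braProduct_le (U x) hu
    obtain ⟨z, hz, h3⟩ := exists_sq_norm_braProduct_eq hn x
    rw [hU, ← h3, ← h1] at h2
    -- This reads `‖x‖⁴ ≤ ‖x‖²`.
    have h4 := h2.trans (pow_le_pow_left₀ (norm_nonneg _) (norm_braProduct_le hz x) 2)
    by_contra! h5
    nlinarith [h5, h4, one_lt_pow₀ h5 two_ne_zero]
  obtain ⟨u, hu, h1⟩ := exists_sq_norm_braProduct_eq hn (U (PiTensorProduct.tprod ℂ w))
  rw [hU, geomMeasure_tprod hn hw, sub_zero, ← inner_toEuclidean_tprod, ← hA,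
    pow_eq_one_iff_of_nonneg (norm_nonneg _) two_ne_zero] at h1
  have hwn := norm_toEuclidean_tprod hw
  have h2 := norm_inner_le_norm (𝕜 := ℂ) (toEuclidean n (A (PiTensorProduct.tprod ℂ u)))
      (toEuclidean n (PiTensorProduct.tprod ℂ w))
  rw [h1, hwn, mul_one] at h2
  have h3 : ‖toEuclidean n (A (PiTensorProduct.tprod ℂ u))‖ = 1 := le_antisymm (hle u hu) h2
  obtain ⟨c, hc0, hc⟩ := (norm_inner_eq_norm_iff (𝕜 := ℂ)
    (x := toEuclidean n (A (PiTensorProduct.tprod ℂ u)))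
    (y := toEuclidean n (PiTensorProduct.tprod ℂ w))
    (by rw [← norm_ne_zero_iff, h3]; exact one_ne_zero)
    (by rw [← norm_ne_zero_iff, hwn]; exact one_ne_zero)).1 (by rw [h1, h3, hwn, one_mul])
  have hcn : ‖c‖ = 1 := by
    have := congrArg norm hc
    rwa [norm_smul, h3, hwn, mul_one, eq_comm] at this
  rw [← map_smul, (toEuclidean n).injective.eq_iff] at hc
  -- The phase `c` is absorbed into one factor of the product vector.
  let i₀ : Fin p := ⟨0, hp⟩
  refine ⟨Function.update u i₀ (c • u i₀), fun i => ?_, ?_⟩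
  · rcases eq_or_ne i i₀ with rfl | hi
    · simp [norm_smul, hcn, hu]
    · simp [hi, hu]
  · rw [MultilinearMap.map_update_smul, Function.update_eq_self, map_smul, hc]

end Overlap

/-! ### Invariance under local unitaries and swaps. -/

section LocalUnitaries

variable {p : ℕ} {n : Fin p → ℕ} (V : ∀ i, Matrix.unitaryGroup (Fin (n i)) ℂ)
  (σ : Equiv.Perm (Fin p)) (hσ : ∀ i, n (σ i) = n i)

/-- The action of a swap operator after local unitaries on tuples of vectors. -/
noncomputable def swapUnitary (w : ∀ i, EuclideanSpace ℂ (Fin (n i))) (i : Fin p) :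
    EuclideanSpace ℂ (Fin (n i)) :=
  factorCast (hσ i) (Matrix.toEuclideanLin (V (σ i) : Matrix _ _ ℂ) (w (σ i)))

theorem swapOperator_map_tprod (w : ∀ i, EuclideanSpace ℂ (Fin (n i))) :
    (swapOperator σ hσ ∘ₗ PiTensorProduct.map fun i =>
      Matrix.toEuclideanLin (V i : Matrix (Fin (n i)) (Fin (n i)) ℂ))
      (PiTensorProduct.tprod ℂ w) = PiTensorProduct.tprod ℂ (swapUnitary V σ hσ w) := by
  rw [LinearMap.comp_apply, PiTensorProduct.map_tprod, swapOperator_tprod]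
  rfl

theorem inner_swapUnitary (w v : ∀ i, EuclideanSpace ℂ (Fin (n i))) (i : Fin p) :
    inner ℂ (swapUnitary V σ hσ w i) (swapUnitary V σ hσ v i) = inner ℂ (w (σ i)) (v (σ i)) := by
  rw [swapUnitary, swapUnitary, inner_factorCast,
    (mem_unitaryGroup_iff_inner _).1 (V (σ i)).2]

theorem norm_swapUnitary (w : ∀ i, EuclideanSpace ℂ (Fin (n i))) (i : Fin p) :
    ‖swapUnitary V σ hσ w i‖ = ‖w (σ i)‖ := by
  rw [@norm_eq_sqrt_re_inner ℂ, @norm_eq_sqrt_re_inner ℂ _ _ _ _ (w (σ i)), inner_swapUnitary]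

theorem braProduct_swapUnitary (w : ∀ i, EuclideanSpace ℂ (Fin (n i))) (v : MultiSpace n) :
    braProduct (swapUnitary V σ hσ w) ((swapOperator σ hσ ∘ₗ PiTensorProduct.map fun i =>
      Matrix.toEuclideanLin (V i : Matrix (Fin (n i)) (Fin (n i)) ℂ)) v) = braProduct w v := by
  refine LinearMap.congr_fun (f := braProduct (swapUnitary V σ hσ w) ∘ₗ _)
    (PiTensorProduct.ext (MultilinearMap.ext fun u => ?_)) v
  rw [LinearMap.compMultilinearMap_apply, LinearMap.comp_apply, swapOperator_map_tprod,
    LinearMap.compMultilinearMap_apply, braProduct_tprod, braProduct_tprod,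
    ← Equiv.prod_comp σ fun i => inner ℂ (w i) (u i)]
  exact Finset.prod_congr rfl fun i _ => inner_swapUnitary V σ hσ w u i

theorem swapUnitary_surjective : Function.Surjective (swapUnitary V σ hσ) := by
  intro w
  have : ∀ i, ∃ u, factorCast (hσ i) (Matrix.toEuclideanLin
      (V (σ i) : Matrix (Fin (n (σ i))) (Fin (n (σ i))) ℂ) u) = w i := by
    intro i
    have hinj : Function.Injective (Matrix.toEuclideanLin
        (V (σ i) : Matrix (Fin (n (σ i))) (Fin (n (σ i))) ℂ)) := by
      refine (injective_iff_map_eq_zero _).2 fun x hx => ?_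
      rw [← inner_self_eq_zero (𝕜 := ℂ), ← (mem_unitaryGroup_iff_inner _).1 (V (σ i)).2, hx,
        inner_zero_left]
    obtain ⟨u, hu⟩ := LinearMap.injective_iff_surjective.1 hinj ((factorCast (hσ i)).symm (w i))
    exact ⟨u, by rw [hu, LinearEquiv.apply_symm_apply]⟩
  choose u hu using this
  refine ⟨Equiv.piCongrLeft (fun i => EuclideanSpace ℂ (Fin (n i))) σ u, funext fun i => ?_⟩
  rw [swapUnitary, Equiv.piCongrLeft_apply_apply, hu]

/-- The substitution `w ↦ swapUnitary V σ hσ w` maps the unit tuples onto themselves and preserves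
overlaps, so it only reindexes the supremum. -/
theorem geomMeasure_swapOperator_map (v : MultiSpace n) :
    geomMeasure ((swapOperator σ hσ ∘ₗ PiTensorProduct.map fun i =>
      Matrix.toEuclideanLin (V i : Matrix (Fin (n i)) (Fin (n i)) ℂ)) v) = geomMeasure v := by
  let Φ : {w : ∀ i, EuclideanSpace ℂ (Fin (n i)) // ∀ i, ‖w i‖ = 1} →
      {w : ∀ i, EuclideanSpace ℂ (Fin (n i)) // ∀ i, ‖w i‖ = 1} := fun w =>
    ⟨swapUnitary V σ hσ w.1, fun i => by rw [norm_swapUnitary, w.2]⟩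
  have hΦ : Function.Surjective Φ := by
    rintro ⟨w, hw⟩
    obtain ⟨u, rfl⟩ := swapUnitary_surjective V σ hσ w
    refine ⟨⟨u, fun j => ?_⟩, rfl⟩
    obtain ⟨i, rfl⟩ := σ.surjective j
    rw [← norm_swapUnitary V σ hσ, hw]
  rw [geomMeasure, geomMeasure, ← hΦ.iSup_comp]
  simp only [Φ, braProduct_swapUnitary]

end LocalUnitaries

/-! ### The structure of preservers. -/

section Preservers

variable {p : ℕ} {n : Fin p → ℕ}

theorem exists_eq_swapOperator_of_geomMeasure_eq (hp : 1 ≤ p) (hn : ∀ i, n i ≠ 0)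
    (U : MultiSpace n →ₗ[ℂ] MultiSpace n) (hU : ∀ v, geomMeasure (U v) = geomMeasure v) :
    ∃ (V : ∀ i, Matrix.unitaryGroup (Fin (n i)) ℂ) (σ : Equiv.Perm (Fin p))
      (hσ : ∀ i, n (σ i) = n i),
      U = swapOperator σ hσ ∘ₗ
        PiTensorProduct.map fun i =>
          Matrix.toEuclideanLin (V i : Matrix (Fin (n i)) (Fin (n i)) ℂ) := by
  have : FiniteDimensional ℂ (MultiSpace n) := (stdBasis n).finiteDimensional_of_finite
  let r := toEuclidean n
  let A : MultiSpace n →ₗ[ℂ] MultiSpace n := r.symm.toLinearMap ∘ₗ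
    LinearMap.adjoint (r.toLinearMap ∘ₗ U ∘ₗ r.symm.toLinearMap) ∘ₗ r.toLinearMap
  have hA : ∀ x y, inner ℂ (r (A x)) (r y) = inner ℂ (r x) (r (U y)) := by
    intro x y
    simp [A, LinearMap.adjoint_inner_left]
  have hAsurj : Function.Surjective A := by
    rw [← LinearMap.range_eq_top, eq_top_iff, ← (stdBasis n).span_eq, Submodule.span_le]
    rintro _ ⟨j, rfl⟩
    obtain ⟨y, -, hy⟩ := exists_adjoint_tprod_eq hp hn U A hU hA
      (w := fun i => EuclideanSpace.single (j i) 1) fun i => by simp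
    exact ⟨_, hy.trans (stdBasis_apply j).symm⟩
  have hUinj : Function.Injective U := by
    refine (injective_iff_map_eq_zero _).2 fun y hy => ?_
    obtain ⟨x, hx⟩ := hAsurj y
    have := hA x y
    rw [hy, map_zero, inner_zero_right, hx, inner_self_eq_zero] at this
    simpa using this
  let Ae := LinearEquiv.ofBijective A ⟨LinearMap.injective_iff_surjective.2 hAsurj, hAsurj⟩
  let Ue := LinearEquiv.ofBijective U ⟨hUinj, LinearMap.injective_iff_surjective.1 hUinj⟩
  have hUU : ∀ v, U (Ue.symm v) = v := Ue.apply_symm_apply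
  have hAA : ∀ v, A (Ae.symm v) = v := Ae.apply_symm_apply
  have hU' : ∀ v, geomMeasure (Ue.symm v) = geomMeasure v := fun v => by
    rw [← hU, hUU]
  have hA' : ∀ x y, inner ℂ (r (Ae.symm x)) (r y) = inner ℂ (r x) (r (Ue.symm y)) := by
    intro x y
    conv_lhs => rw [← hUU y]
    rw [← hA, hAA]
  obtain ⟨V, σ, hσ, hV⟩ := exists_eq_swapOperator_comp_map hp hn Ae.symm
    (fun v hv => by
      obtain ⟨y, hy, hyv⟩ := exists_adjoint_tprod_eq hp hn U A hU hA hv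
      exact ⟨y, hy, Ae.symm_apply_eq.2 hyv.symm⟩)
    (fun v hv => by
      obtain ⟨y, hy, hyv⟩ := exists_adjoint_tprod_eq hp hn Ue.symm.toLinearMap
        Ae.symm.toLinearMap hU' hA' hv
      exact ⟨y, hy, (Ae.symm_apply_eq.1 hyv).symm⟩)
  -- The form found for `A⁻¹` transfers to `U` by comparing overlaps: with `A w = y`, `⟨w, U v⟩ =
  -- ⟨y, v⟩ = ⟨A⁻¹ y, A⁻¹ v⟩ = ⟨w, A⁻¹ v⟩`.
  refine ⟨V, σ, hσ, LinearMap.ext fun v => ext_braProduct fun w hw => ?_⟩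
  obtain ⟨y, -, hyw⟩ := exists_adjoint_tprod_eq hp hn Ue.symm.toLinearMap
    Ae.symm.toLinearMap hU' hA' hw
  have hy : A (PiTensorProduct.tprod ℂ w) = PiTensorProduct.tprod ℂ y :=
    (Ae.symm_apply_eq.1 hyw).symm
  rw [hV, swapOperator_map_tprod] at hyw
  rw [← inner_toEuclidean_tprod, ← hA, hy, inner_toEuclidean_tprod,
    ← braProduct_swapUnitary V σ hσ, ← inner_toEuclidean_tprod, hyw, inner_toEuclidean_tprod]

end Preservers

end GeomEnt

theorem mainTheorem11 {p : ℕ} (hp : 1 ≤ p) (n : Fin p → ℕ)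
    (U : GeomEnt.MultiSpace n →ₗ[ℂ] GeomEnt.MultiSpace n) :
    (∀ v : GeomEnt.MultiSpace n, GeomEnt.IsPureState v →
        GeomEnt.geomMeasure (U v) = GeomEnt.geomMeasure v) ↔
      ∃ (V : ∀ i, Matrix.unitaryGroup (Fin (n i)) ℂ) (σ : Equiv.Perm (Fin p))
        (hσ : ∀ i, n (σ i) = n i),
        U = GeomEnt.swapOperator σ hσ ∘ₗ
          PiTensorProduct.map fun i =>
            Matrix.toEuclideanLin (V i : Matrix (Fin (n i)) (Fin (n i)) ℂ) := by
  constructor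
  · intro h
    by_cases hn : ∀ i, n i ≠ 0
    · exact GeomEnt.exists_eq_swapOperator_of_geomMeasure_eq hp hn U
        (GeomEnt.geomMeasure_map_eq_of_forall_isPureState U h)
    -- A zero-dimensional factor makes the whole space zero, and the identity data serve.
    · push Not at hn
      obtain ⟨i, hi⟩ := hn
      have : IsEmpty (∀ i, Fin (n i)) := ⟨fun j => by
        have := (j i).2
        omega⟩
      have : Subsingleton (GeomEnt.MultiSpace n) :=
        (GeomEnt.stdBasis n).repr.injective.subsingleton
      exact ⟨1, 1, fun _ => rfl, LinearMap.ext fun v => Subsingleton.elim _ _⟩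
  · rintro ⟨V, σ, hσ, rfl⟩ v -
    exact GeomEnt.geomMeasure_swapOperator_map V σ hσ v
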